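/- An octahedral system is an $n$-uniform $n$-partite hypergraph $\Omega=(V_1,\ldots,V_n,E)$ (its vertex set is the disjoint union of the finite sets $V_1,\ldots,V_n$, and each edge contains exactly one vertex of each $V_i$) such that $|V_i|\ge 2$ for all $i$ and such that, for every set $X\subseteq\bigcup_{i=1}^n V_i$ with $|X\cap V_i|=2$ for $i=1,\ldots,n$, the number of edges contained in $X$ is even. It is without isolated vertex if each vertex belongs to at least one edge. Theorem. Let $m$ and $n$ be integers with $4\le m\le n$. Every octahedral system $\Omega=(V_1,\ldots,V_n,E)$ without isolated vertex and with $|V_1|=|V_2|=\cdots=|V_n|=m$ has at least $\frac12 m^2+\frac52 m-11$ edges. -/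

import Mathlib

/-- A (finite) `n`-uniform `n`-partite hypergraph `(V₁, …, Vₙ, E)`: the vertex set is the disjoint
union of `V₁, …, Vₙ`, and each edge meets each `Vᵢ` in exactly one vertex. -/
structure PartiteHypergraph (α : Type*) [DecidableEq α] (n : ℕ) where
  /-- the vertex classes -/
  V : Fin n → Finset α
  /-- the set of edges -/
  E : Finset (Finset α)
  disjoint : ∀ i j : Fin n, i ≠ j → Disjoint (V i) (V j)
  subset_of_mem : ∀ e ∈ E, e ⊆ Finset.univ.biUnion V
  card_inter_of_mem : ∀ e ∈ E, ∀ i : Fin n, (e ∩ V i).card = 1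

namespace PartiteHypergraph

/-- The vertex set `V₁ ∪ … ∪ Vₙ`. -/
def vertexSet {α : Type*} [DecidableEq α] {n : ℕ} (Ω : PartiteHypergraph α n) : Finset α :=
  Finset.univ.biUnion Ω.V

/-- The set `E[X]` of the edges induced by a set `X` of vertices. -/
def inducedEdges {α : Type*} [DecidableEq α] {n : ℕ} (Ω : PartiteHypergraph α n)
    (X : Finset α) : Finset (Finset α) :=
  Ω.E.filter (fun e => e ⊆ X)

/-- An octahedral system: every class has at least two vertices, and a set `X` of vertices that
meets each class in exactly two vertices induces an even number of edges. -/
structure IsOctahedralSystem {α : Type*} [DecidableEq α] {n : ℕ}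
    (Ω : PartiteHypergraph α n) : Prop where
  two_le_card : ∀ i : Fin n, 2 ≤ (Ω.V i).card
  parity : ∀ X : Finset α, X ⊆ Ω.vertexSet → (∀ i : Fin n, (X ∩ Ω.V i).card = 2) →
    Even (Ω.inducedEdges X).card

/-- There is no isolated vertex: each vertex belongs to at least one edge. -/
def NoIsolatedVertex {α : Type*} [DecidableEq α] {n : ℕ} (Ω : PartiteHypergraph α n) : Prop :=
  ∀ v ∈ Ω.vertexSet, ∃ e ∈ Ω.E, v ∈ e

end PartiteHypergraph

/-! Encode the edges as a `ZMod 2`-valued function on transversals, with classes of size m = d + 2.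
The sum of two slices in one class is octahedral with one class fewer, which drives the inductions.
The bound obtained is m(m - 2) + 2, the case c = m of `IsOctahedral.card_mul_add_two_le`: covering c
≤ m classes takes at least cd + 2 transversals. Take a covered class and its smallest slice; if that
has at least m points, there are m² in all. If some other class to be covered is covered by no
difference with this slice, `IsOctahedral.card_mul_card_le` gives m² again. Otherwise assign each
remaining class to a slice whose difference covers it. Induction bounds these slices below, and the
umbrella structure of small systems leaves at most one of them with d points or fewer;
`le_sum_of_slice_bounds` adds up. -/

namespace Octahedral

/-! ### Octahedral functions and their slices -/

variable {A : Type*} {n : ℕ}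

/-- The indicator `f` of a set of transversals has an even number of points in every octahedron. -/
def IsOctahedral (f : (Fin n → A) → ZMod 2) : Prop :=
  ∀ a b : Fin n → A, (∀ i, a i ≠ b i) →
    ∑ σ : Fin n → Bool, f (fun i => if σ i then a i else b i) = 0

/-- The restriction of `f` to the transversals through the vertex `x` of class `i`. -/
def slice (i : Fin (n + 1)) (f : (Fin (n + 1) → A) → ZMod 2) (x : A) : (Fin n → A) → ZMod 2 :=
  fun p => f (i.insertNth x p)

/-- Every vertex of class `j` lies on a transversal in the support of `f`. -/
def Covers (f : (Fin n → A) → ZMod 2) (j : Fin n) : Prop :=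
  ∀ v, ∃ p, f p ≠ 0 ∧ p j = v

/-- The support of `f` is the set of transversals that agree with `q` outside class `i`. -/
def IsUmbrella (f : (Fin n → A) → ZMod 2) : Prop :=
  ∃ (i : Fin n) (q : Fin n → A), ∀ p, f p ≠ 0 ↔ ∀ j, j ≠ i → p j = q j

theorem add_self_eq_zero' (f : (Fin n → A) → ZMod 2) : f + f = 0 := by
  funext p
  exact CharTwo.add_self_eq_zero _

theorem add_eq_zero_iff' {f g : (Fin n → A) → ZMod 2} : f + g = 0 ↔ f = g := by
  constructor
  · intro h
    funext p
    have := congrFun h p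
    exact CharTwo.add_eq_zero.1 this
  · rintro rfl
    exact add_self_eq_zero' f

theorem isOctahedral_zero : IsOctahedral (0 : (Fin n → A) → ZMod 2) := by
  intro a b _
  simp

/-- Adding x and y in class `i` completes a smaller octahedron to one for `f`, whose sum splits by
the vertex used in class `i`. -/
theorem IsOctahedral.slice_add {f : (Fin (n + 1) → A) → ZMod 2} (hf : IsOctahedral f)
    (i : Fin (n + 1)) (x y : A) : IsOctahedral (slice i f x + slice i f y) := by
  by_cases hxy : x = y
  · subst hxy
    rw [add_self_eq_zero']
    exact isOctahedral_zero
  intro a b hab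
  have h := hf (i.insertNth x a) (i.insertNth y b) (by
    intro j
    refine Fin.succAboveCases i ?_ (fun k => ?_) j
    · simpa using hxy
    · simpa using hab k)
  rw [← (Fin.insertNthEquiv (fun _ => Bool) i).sum_comp, Fintype.sum_prod_type] at h
  simp only [Fintype.sum_bool] at h
  rw [← Finset.sum_add_distrib] at h
  rw [← h]
  refine Finset.sum_congr rfl fun τ _ => ?_
  have key : ∀ c : Bool, (fun j => if (Fin.insertNthEquiv (fun _ => Bool) i) (c, τ) j
      then (i.insertNth x a : Fin (n + 1) → A) j else (i.insertNth y b : Fin (n + 1) → A) j) =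
      i.insertNth (if c then x else y) (fun k => if τ k then a k else b k) := by
    intro c
    funext j
    refine Fin.succAboveCases i ?_ (fun k => ?_) j <;> simp [Fin.insertNthEquiv]
  rw [key, key]
  simp [slice]

theorem IsOctahedral.slice_of_slice_eq_zero {f : (Fin (n + 1) → A) → ZMod 2}
    (hf : IsOctahedral f) {i : Fin (n + 1)} {x : A} (hx : slice i f x = 0) (y : A) :
    IsOctahedral (slice i f y) := by
  simpa [hx] using hf.slice_add i x y

theorem IsOctahedral.eq_zero {f : (Fin 0 → A) → ZMod 2} (hf : IsOctahedral f) : f = 0 := by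
  funext p
  have := hf p p (fun i => i.elim0)
  simp only [Finset.univ_unique, Finset.sum_singleton] at this
  rw [Subsingleton.elim p (fun i => _)]
  exact this

theorem exists_slice_eq_zero {f : (Fin (n + 1) → A) → ZMod 2} {i : Fin (n + 1)}
    (h : ¬ Covers f i) : ∃ x, slice i f x = 0 := by
  simp only [Covers, not_forall, not_exists, not_and] at h
  obtain ⟨x, hx⟩ := h
  refine ⟨x, ?_⟩
  funext p
  by_contra hp
  exact hx _ hp (by simp)

theorem Covers.slice_ne_zero {f : (Fin (n + 1) → A) → ZMod 2} {i : Fin (n + 1)}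
    (h : Covers f i) (x : A) : slice i f x ≠ 0 := by
  obtain ⟨p, hp, rfl⟩ := h x
  intro h0
  apply hp
  have := congrFun h0 (i.removeNth p)
  simpa [slice] using this

theorem Covers.ne_zero [Nonempty A] {f : (Fin n → A) → ZMod 2} {i : Fin n}
    (h : Covers f i) : f ≠ 0 := by
  obtain ⟨p, hp, -⟩ := h (Classical.arbitrary A)
  rintro rfl
  exact hp rfl

theorem eq_of_slice_eq {f g : (Fin (n + 1) → A) → ZMod 2} (i : Fin (n + 1))
    (h : ∀ x, slice i f x = slice i g x) : f = g := by
  funext p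
  have := congrFun (h (p i)) (i.removeNth p)
  simpa [slice] using this

theorem IsUmbrella.of_slice {f : (Fin (n + 1) → A) → ZMod 2} {i : Fin (n + 1)} {x : A}
    (hx : IsUmbrella (slice i f x)) (h0 : ∀ y, y ≠ x → slice i f y = 0) : IsUmbrella f := by
  obtain ⟨k, q, hq⟩ := hx
  refine ⟨i.succAbove k, i.insertNth x q, fun p => ?_⟩
  have hp : f p = slice i f (p i) (i.removeNth p) := by simp [slice]
  rw [hp]
  constructor
  · intro h
    have hpx : p i = x := by
      by_contra hne
      exact h (congrFun (h0 _ hne) _)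
    rw [hpx, hq] at h
    intro j
    refine Fin.succAboveCases i ?_ (fun l => ?_) j
    · simpa using hpx
    · intro hl
      simpa [Fin.removeNth] using h l (fun e => hl (by rw [e]))
  · intro h
    have hpx : p i = x := by simpa using h i (Fin.succAbove_ne i k).symm
    rw [hpx, hq]
    intro l hl
    simpa [Fin.removeNth] using h (i.succAbove l) (fun e => hl (Fin.succAbove_right_injective e))

/-! ### Sizes of supports -/

variable [Fintype A]

theorem hammingNorm_eq_sum_slice (i : Fin (n + 1)) (f : (Fin (n + 1) → A) → ZMod 2) :
    hammingNorm f = ∑ x, hammingNorm (slice i f x) := by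
  simp only [hammingNorm, Finset.card_filter]
  rw [← (Fin.insertNthEquiv (fun _ => A) i).sum_comp, Fintype.sum_prod_type]
  rfl

theorem hammingNorm_add_le (f g : (Fin n → A) → ZMod 2) :
    hammingNorm (f + g) ≤ hammingNorm f + hammingNorm g := by
  have := hammingDist_triangle f 0 (-g)
  rw [hammingDist_eq_hammingNorm, hammingDist_zero_right, hammingDist_zero_left] at this
  simpa [hammingNorm, CharTwo.neg_eq, CharTwo.sub_eq_add] using this

theorem hammingNorm_add_hammingNorm (f g : (Fin n → A) → ZMod 2) :
    hammingNorm f + hammingNorm g =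
      hammingNorm (f + g) + 2 * (Finset.univ.filter fun p => f p ≠ 0 ∧ g p ≠ 0).card := by
  simp only [hammingNorm, Finset.card_filter, Finset.mul_sum, ← Finset.sum_add_distrib]
  refine Finset.sum_congr rfl fun p _ => ?_
  have h11 : ∀ a b : ZMod 2, a ≠ 0 → b ≠ 0 → a + b = 0 := by decide
  by_cases hf : f p = 0 <;> by_cases hg : g p = 0
  · simp [hf, hg]
  · simp [hf, hg]
  · simp [hf, hg]
  · simp [hf, hg, h11 _ _ hf hg]

/-- Two different slices have a nonzero octahedral difference, so induction applies to it; if all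
slices agree, each is nonzero. -/
theorem card_le_hammingNorm {f : (Fin n → A) → ZMod 2} (hf : IsOctahedral f) (h0 : f ≠ 0) :
    Fintype.card A ≤ hammingNorm f := by
  classical
  induction n with
  | zero => exact absurd hf.eq_zero h0
  | succ n ih =>
    rw [hammingNorm_eq_sum_slice 0]
    by_cases hc : ∀ x y, slice 0 f x = slice 0 f y
    · have hne : ∀ x, slice 0 f x ≠ 0 := by
        intro x hx
        exact h0 (eq_of_slice_eq 0 fun y => (hc y x).trans hx)
      calc Fintype.card A = ∑ _x : A, 1 := by simp
        _ ≤ _ := Finset.sum_le_sum fun x _ => hammingNorm_pos_iff.2 (hne x)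
    · push Not at hc
      obtain ⟨x, y, hxy⟩ := hc
      have hne : x ≠ y := fun h => hxy (by rw [h])
      have h1 := ih (hf.slice_add 0 x y) (fun h => hxy (add_eq_zero_iff'.1 h))
      have h2 := hammingNorm_add_le (slice 0 f x) (slice 0 f y)
      have h3 : ∑ z ∈ {x, y}, hammingNorm (slice 0 f z) ≤ ∑ z, hammingNorm (slice 0 f z) :=
        Finset.sum_le_sum_of_subset (Finset.subset_univ _)
      rw [Finset.sum_pair hne] at h3
      omega

/-! ### Small systems are umbrellas -/

theorem IsUmbrella.of_slice_const {f : (Fin (n + 1) → A) → ZMod 2} {i : Fin (n + 1)} {x : A}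
    (hc : ∀ y, slice i f y = slice i f x) (h1 : hammingNorm (slice i f x) = 1) :
    IsUmbrella f := by
  obtain ⟨q, hq⟩ := Finset.card_eq_one.1 h1
  have hq' : ∀ p, slice i f x p ≠ 0 ↔ p = q := fun p => by
    simpa using Finset.ext_iff.1 hq p
  refine ⟨i, i.insertNth x q, fun p => ?_⟩
  have hp : f p = slice i f (p i) (i.removeNth p) := by simp [slice]
  rw [hp, hc, hq']
  constructor
  · rintro rfl j
    refine Fin.succAboveCases i ?_ (fun l => ?_) j
    · simp
    · simp [Fin.removeNth]
  · intro h
    funext l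
    simpa [Fin.removeNth] using h (i.succAbove l) (Fin.succAbove_ne i l)

/-- Octahedral systems of small size are umbrellas. -/
theorem IsOctahedral.isUmbrella {d : ℕ} (hA : Fintype.card A = d + 2)
    {f : (Fin n → A) → ZMod 2} (hf : IsOctahedral f)
    (h0 : f ≠ 0) (hlt : hammingNorm f < 2 * d + 2) : IsUmbrella f := by
  classical
  induction n with
  | zero => exact absurd hf.eq_zero h0
  | succ n ih =>
    have hsum := hammingNorm_eq_sum_slice 0 f
    have hpair : ∀ x y, x ≠ y →
        hammingNorm (slice 0 f x) + hammingNorm (slice 0 f y) ≤ hammingNorm f := by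
      intro x y hne
      rw [hsum, ← Finset.sum_pair (f := fun z => hammingNorm (slice 0 f z)) hne]
      exact Finset.sum_le_sum_of_subset (Finset.subset_univ _)
    by_cases hcov : Covers f 0
    · have : Nonempty A := Fintype.card_pos_iff.1 (by omega)
      obtain ⟨x, hx⟩ := Finite.exists_min (fun x => hammingNorm (slice 0 f x))
      have hpos : 0 < hammingNorm (slice 0 f x) := hammingNorm_pos_iff.2 (hcov.slice_ne_zero x)
      have hmul : (d + 2) * hammingNorm (slice 0 f x) ≤ hammingNorm f := by
        rw [hsum, ← hA, ← smul_eq_mul]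
        exact Finset.card_nsmul_le_sum _ _ _ fun y _ => hx y
      have h1 : hammingNorm (slice 0 f x) = 1 := by
        by_contra hne
        have : (d + 2) * 2 ≤ (d + 2) * hammingNorm (slice 0 f x) :=
          Nat.mul_le_mul_left _ (by omega)
        omega
      by_cases hc : ∀ y, slice 0 f y = slice 0 f x
      · exact .of_slice_const hc h1
      · push Not at hc
        obtain ⟨u, hu⟩ := hc
        have hux : u ≠ x := fun h => hu (by rw [h])
        -- Slice `u` has at least d + 1 points and the other d + 1 slices at least one each: too
        -- many.
        have hg := card_le_hammingNorm (hf.slice_add 0 u x) (fun h => hu (add_eq_zero_iff'.1 h))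
        have hg' := hammingNorm_add_le (slice 0 f u) (slice 0 f x)
        have hrest : (Finset.univ.erase u).card • 1 ≤
            ∑ y ∈ Finset.univ.erase u, hammingNorm (slice 0 f y) :=
          Finset.card_nsmul_le_sum _ _ _ fun y _ => hpos.trans_le (hx y)
        rw [Finset.card_erase_of_mem (Finset.mem_univ _), Finset.card_univ, hA,
          smul_eq_mul] at hrest
        have := Finset.add_sum_erase Finset.univ (fun y => hammingNorm (slice 0 f y))
          (Finset.mem_univ u)
        omega
    · obtain ⟨z, hz⟩ := exists_slice_eq_zero hcov
      have hoct := hf.slice_of_slice_eq_zero hz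
      obtain ⟨x, hx⟩ : ∃ x, slice 0 f x ≠ 0 := by
        by_contra! hall
        exact h0 (eq_of_slice_eq 0 hall)
      have hxn := card_le_hammingNorm (hoct x) hx
      -- All slices are octahedral here, so two nonzero ones would give 2(d + 2) points.
      have hzero : ∀ y, y ≠ x → slice 0 f y = 0 := by
        intro y hy
        by_contra hne
        have := card_le_hammingNorm (hoct y) hne
        have := hpair y x hy
        omega
      have hle := hpair x z (fun h => hx (h ▸ hz))
      exact .of_slice (ih (hoct x) hx (by omega)) hzero

/-- With the same free class, a shared transversal forces equality; with different ones, every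
coordinate of a shared transversal is prescribed. -/
theorem IsUmbrella.card_inter_le_one {f g : (Fin n → A) → ZMod 2} (hf : IsUmbrella f)
    (hg : IsUmbrella g) (hne : f ≠ g) :
    (Finset.univ.filter fun p => f p ≠ 0 ∧ g p ≠ 0).card ≤ 1 := by
  obtain ⟨i, q, hq⟩ := hf
  obtain ⟨j, r, hr⟩ := hg
  rw [Finset.card_le_one]
  intro a ha b hb
  simp only [Finset.mem_filter, Finset.mem_univ, true_and, hq, hr] at ha hb
  by_cases hij : i = j
  · subst hij
    refine absurd ?_ hne
    funext p
    have : f p ≠ 0 ↔ g p ≠ 0 := by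
      rw [hq, hr]
      refine forall₂_congr fun l hl => ?_
      rw [← ha.1 l hl, ← ha.2 l hl]
    revert this
    generalize f p = s
    generalize g p = t
    revert s t
    decide
  · funext l
    by_cases hl : l = i
    · have hl' : l ≠ j := fun h => hij (hl.symm.trans h)
      rw [ha.2 l hl', hb.2 l hl']
    · rw [ha.1 l hl, hb.1 l hl]

/-- Of two distinct octahedral systems and their difference, one is not small. -/
theorem IsOctahedral.le_hammingNorm_add {d : ℕ} (hA : Fintype.card A = d + 2)
    {f g : (Fin n → A) → ZMod 2} (hf : IsOctahedral f) (hg : IsOctahedral g)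
    (hf0 : f ≠ 0) (hg0 : g ≠ 0) (hne : f ≠ g)
    (hfl : hammingNorm f < 2 * d + 2) (hgl : hammingNorm g < 2 * d + 2) :
    2 * d + 2 ≤ hammingNorm (f + g) := by
  have h1 := (hf.isUmbrella hA hf0 hfl).card_inter_le_one (hg.isUmbrella hA hg0 hgl) hne
  have h2 := hammingNorm_add_hammingNorm f g
  have h3 := card_le_hammingNorm hf hf0
  have h4 := card_le_hammingNorm hg hg0
  omega

/-! ### Lower bounds from covered classes -/

/-- Each difference misses a vertex of class `j`, so all its slices there are octahedral. This
forces degree at least |A| at every vertex of class `j`. -/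
theorem IsOctahedral.card_mul_card_le {f : (Fin (n + 2) → A) → ZMod 2} (hf : IsOctahedral f)
    {i : Fin (n + 2)} {j : Fin (n + 1)} (hj : Covers f (i.succAbove j)) {x : A}
    (hx : hammingNorm (slice i f x) < Fintype.card A)
    (hnc : ∀ u, ¬ Covers (slice i f u + slice i f x) j) :
    Fintype.card A * Fintype.card A ≤ hammingNorm f := by
  have hadd : ∀ u v, slice j (slice i f u + slice i f x) v =
      slice j (slice i f u) v + slice j (slice i f x) v := fun u v => rfl
  have hoct : ∀ u v, IsOctahedral (slice j (slice i f u + slice i f x) v) := by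
    intro u
    obtain ⟨z, hz⟩ := exists_slice_eq_zero (hnc u)
    exact (hf.slice_add i u x).slice_of_slice_eq_zero hz
  have hdeg : ∀ v, Fintype.card A ≤ ∑ u, hammingNorm (slice j (slice i f u) v) := by
    intro v
    by_cases hT : slice j (slice i f x) v = 0
    · obtain ⟨p, hp, hpv⟩ := hj v
      have hne : slice j (slice i f (p i)) v ≠ 0 := by
        intro h
        apply hp
        have := congrFun h (j.removeNth (i.removeNth p))
        have hv : v = i.removeNth p j := hpv.symm
        rw [hv] at this
        simpa [slice] using this
      have ho := hoct (p i) v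
      rw [hadd, hT, add_zero] at ho
      exact (card_le_hammingNorm ho hne).trans
        (Finset.single_le_sum (f := fun u => hammingNorm (slice j (slice i f u) v))
          (fun _ _ => Nat.zero_le _) (Finset.mem_univ (p i)))
    · have hne : ∀ u, slice j (slice i f u) v ≠ 0 := by
        intro u hu
        have ho := hoct u v
        rw [hadd, hu, zero_add] at ho
        have h1 := card_le_hammingNorm ho hT
        rw [hammingNorm_eq_sum_slice j] at hx
        have h2 := Finset.single_le_sum
          (f := fun w => hammingNorm (slice j (slice i f x) w))
          (fun _ _ => Nat.zero_le _) (Finset.mem_univ v)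
        exact absurd (h1.trans h2) (not_le.2 hx)
      calc Fintype.card A = ∑ _u : A, 1 := by simp
        _ ≤ _ := Finset.sum_le_sum fun u _ => hammingNorm_pos_iff.2 (hne u)
  rw [hammingNorm_eq_sum_slice i]
  simp only [hammingNorm_eq_sum_slice j]
  rw [Finset.sum_comm]
  calc Fintype.card A * Fintype.card A = ∑ _v : A, Fintype.card A := by simp
    _ ≤ _ := Finset.sum_le_sum fun v _ => hdeg v

/-- The counting step: `s` gives the slice sizes, `k u` the number of classes covered by the
difference of the slice at `u` and the smallest slice. -/
theorem le_sum_of_slice_bounds [DecidableEq A] {d c t : ℕ} (hA : Fintype.card A = d + 2)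
    {s k : A → ℕ} (W : Finset A) (B : A) (ht : 0 < t) (hmin : ∀ x, t ≤ s x)
    (hk : ∀ u ∈ W, 0 < k u) (hsum : ∑ u ∈ W, k u = c) (hc : c + 1 ≤ d + 2)
    (hs : ∀ u ∈ W, k u * d + 2 ≤ s u + t) (hB : ∀ u ∈ W, u ≠ B → d + 1 ≤ s u) :
    (c + 1) * d + 2 ≤ ∑ x, s x := by
  have hcompl : Wᶜ.card * t ≤ ∑ x ∈ Wᶜ, s x := by
    rw [← smul_eq_mul]
    exact Finset.card_nsmul_le_sum _ _ _ fun x _ => hmin x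
  have hcard : W.card + Wᶜ.card = d + 2 := by rw [Finset.card_add_card_compl, hA]
  have hsplit := Finset.sum_add_sum_compl W s
  -- The correction (t - 1)(2 - k u) is what `hB` gains when k u = 1, and is at most 0 when k u ≥ 2.
  -- Summed, it makes |W| cancel; the exception `B` costs t - 1 once.
  have hpoint : ∀ u ∈ W, (k u * d + 2 - t + (t - 1) * (2 - k u) -
      (if u = B then (t : ℤ) - 1 else 0) : ℤ) ≤ s u := by
    intro u hu
    have h1 : (k u * d + 2 : ℤ) ≤ s u + t := by exact_mod_cast hs u hu
    have h2 : (1 : ℤ) ≤ k u := by exact_mod_cast hk u hu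
    have h3 : (1 : ℤ) ≤ t := by exact_mod_cast ht
    split_ifs with h
    · nlinarith
    · rcases Nat.lt_or_ge (k u) 2 with h4 | h4
      · have h5 : k u = 1 := by have := hk u hu; omega
        have h6 : (d + 1 : ℤ) ≤ s u := by exact_mod_cast hB u hu h
        rw [h5]
        push_cast
        linarith
      · have h6 : (2 : ℤ) ≤ k u := by exact_mod_cast h4
        nlinarith
  have hW := Finset.sum_le_sum hpoint
  have hite : ∑ u ∈ W, (if u = B then (t : ℤ) - 1 else 0) ≤ t - 1 := by
    have h3 : (1 : ℤ) ≤ t := by exact_mod_cast ht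
    rw [Finset.sum_ite_eq']
    split_ifs <;> linarith
  have hkz : ∑ u ∈ W, (k u : ℤ) = c := by exact_mod_cast hsum
  rw [Finset.sum_sub_distrib, Finset.sum_add_distrib, Finset.sum_sub_distrib,
    Finset.sum_add_distrib, ← Finset.sum_mul, ← Finset.mul_sum, Finset.sum_sub_distrib, hkz] at hW
  simp only [Finset.sum_const, nsmul_eq_mul] at hW
  zify at hcompl hcard hsplit hc ht ⊢
  have hprod : (0 : ℤ) ≤ (t - 1) * (d + 2 - (c + 1)) := mul_nonneg (by linarith) (by linarith)
  have hcw : (Wᶜ.card : ℤ) = d + 2 - W.card := by linarith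
  rw [hcw] at hcompl
  nlinarith

/-- An octahedral system with classes of size `d + 2` that covers `K.card` classes. -/
theorem IsOctahedral.card_mul_add_two_le {d : ℕ} (hd : 0 < d) (hA : Fintype.card A = d + 2)
    {f : (Fin n → A) → ZMod 2} (hf : IsOctahedral f) (h0 : f ≠ 0) (K : Finset (Fin n))
    (hK : ∀ j ∈ K, Covers f j) (hKc : K.card ≤ d + 2) :
    K.card * d + 2 ≤ hammingNorm f := by
  classical
  have : Nonempty A := Fintype.card_pos_iff.1 (by omega)
  induction n with
  | zero => exact absurd hf.eq_zero h0
  | succ n ih =>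
    rcases K.eq_empty_or_nonempty with rfl | ⟨i, hi⟩
    · have := card_le_hammingNorm hf h0
      simp only [Finset.card_empty]
      omega
    have hsq : Fintype.card A * Fintype.card A ≤ hammingNorm f →
        K.card * d + 2 ≤ hammingNorm f := by
      rw [hA]
      intro h
      nlinarith [Nat.mul_le_mul_right d hKc]
    obtain ⟨x, hx⟩ := Finite.exists_min (fun x => hammingNorm (slice i f x))
    rcases Nat.lt_or_ge (hammingNorm (slice i f x)) (Fintype.card A) with hlt | hge
    swap
    · refine hsq ?_
      rw [hammingNorm_eq_sum_slice i]
      calc Fintype.card A * Fintype.card A = ∑ _v : A, Fintype.card A := by simp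
        _ ≤ _ := Finset.sum_le_sum fun v _ => hge.trans (hx v)
    set K' : Finset (Fin n) := Finset.univ.filter fun j => i.succAbove j ∈ K with hK'
    have hcard : K.card = K'.card + 1 := by
      have : K = insert i (K'.map i.succAboveEmb) := by
        ext j
        refine Fin.succAboveCases i ?_ (fun l => ?_) j
        · simpa using hi
        · simp [hK', Fin.succAbove_ne]
      rw [this, Finset.card_insert_of_notMem, Finset.card_map]
      simp
    by_cases hcov : ∀ j ∈ K', ∃ u, Covers (slice i f u + slice i f x) j
    swap
    · push Not at hcov
      obtain ⟨j, hj, hnc⟩ := hcov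
      cases n with
      | zero => exact j.elim0
      | succ n => exact hsq (hf.card_mul_card_le (hK _ (by simpa [hK'] using hj)) hlt hnc)
    -- `Function.invFun` fixes one vertex per slice value, so distinct chosen vertices have distinct
    -- slices.
    have hrep : ∀ j, ∃ u, j ∈ K' → (Covers (slice i f u + slice i f x) j ∧
        u = Function.invFun (slice i f) (slice i f u)) := by
      intro j
      by_cases hj : j ∈ K'
      · obtain ⟨u, hu⟩ := hcov j hj
        have he : slice i f (Function.invFun (slice i f) (slice i f u)) = slice i f u :=
          Function.invFun_eq ⟨u, rfl⟩
        exact ⟨Function.invFun (slice i f) (slice i f u), fun _ => ⟨by rwa [he], by rw [he]⟩⟩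
      · exact ⟨x, fun h => absurd h hj⟩
    choose u hu using hrep
    have hinj : ∀ a ∈ K'.image u, ∀ b ∈ K'.image u, slice i f a = slice i f b → a = b := by
      simp only [Finset.mem_image]
      rintro _ ⟨a, ha, rfl⟩ _ ⟨b, hb, rfl⟩ h
      rw [(hu a ha).2, (hu b hb).2, h]
    have hnex : ∀ a ∈ K'.image u, slice i f a + slice i f x ≠ 0 := by
      simp only [Finset.mem_image]
      rintro _ ⟨a, ha, rfl⟩
      exact (hu a ha).1.ne_zero
    -- If both slices had at most d points, their differences with the smallest would be distinct
    -- umbrellas, whose sum has at least 2d + 2 points; but that sum is the sum of the two slices.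
    have hbig : ∀ a ∈ K'.image u, ∀ b ∈ K'.image u, a ≠ b →
        hammingNorm (slice i f a) ≤ d → d + 1 ≤ hammingNorm (slice i f b) := by
      intro a ha b hb hab had
      by_contra hbd
      have h1 := hammingNorm_add_le (slice i f a) (slice i f x)
      have h2 := hammingNorm_add_le (slice i f b) (slice i f x)
      have h3 := hammingNorm_add_le (slice i f a) (slice i f b)
      have hxa := hx a
      have h4 := IsOctahedral.le_hammingNorm_add hA (hf.slice_add i a x) (hf.slice_add i b x)
        (hnex a ha) (hnex b hb) (fun h => hab (hinj a ha b hb (add_right_cancel h)))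
        (by omega) (by omega)
      have h5 : slice i f a + slice i f x + (slice i f b + slice i f x) =
          slice i f a + slice i f b := by
        rw [add_add_add_comm, add_self_eq_zero', add_zero]
      rw [h5] at h4
      omega
    obtain ⟨B, hB⟩ : ∃ B, ∀ a ∈ K'.image u, a ≠ B → d + 1 ≤ hammingNorm (slice i f a) := by
      by_cases h : ∃ B ∈ K'.image u, hammingNorm (slice i f B) ≤ d
      · obtain ⟨B, hBm, hBd⟩ := h
        exact ⟨B, fun a ha hab => hbig B hBm a ha hab.symm hBd⟩
      · push Not at h
        exact ⟨x, fun a ha _ => h a ha⟩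
    rw [hammingNorm_eq_sum_slice i, hcard]
    refine le_sum_of_slice_bounds hA (k := fun a => (K'.filter fun j => u j = a).card)
      (K'.image u) B (hammingNorm_pos_iff.2 ((hK i hi).slice_ne_zero x)) hx ?_
      (Finset.card_eq_sum_card_image u K').symm (by omega) ?_ hB
    · simp only [Finset.mem_image]
      rintro _ ⟨a, ha, rfl⟩
      exact Finset.card_pos.2 ⟨a, by simp [ha]⟩
    · intro a ha
      refine (ih (hf.slice_add i a x) (hnex a ha) (K'.filter fun j => u j = a) ?_ ?_).trans
        (hammingNorm_add_le _ _)
      · intro j hj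
        rw [Finset.mem_filter] at hj
        rw [← hj.2]
        exact (hu j hj.1).1
      · exact (Finset.card_filter_le _ _).trans (by omega)

end Octahedral

/-! ### From hypergraphs to coordinates -/

namespace PartiteHypergraph

open Octahedral

variable {α : Type*} [DecidableEq α] {n m : ℕ} (Ω : PartiteHypergraph α n)
  (ε : ∀ i, Fin m ≃ Ω.V i)

/-- The transversal with coordinates `p`, as a set of vertices. -/
def transversal (p : Fin n → Fin m) : Finset α :=
  Finset.univ.image fun i => (ε i (p i) : α)

/-- The indicator of the edge set in coordinates. -/
def edgeIndicator (p : Fin n → Fin m) : ZMod 2 :=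
  if Ω.transversal ε p ∈ Ω.E then 1 else 0

variable {Ω ε}

theorem edgeIndicator_ne_zero {p : Fin n → Fin m} :
    Ω.edgeIndicator ε p ≠ 0 ↔ Ω.transversal ε p ∈ Ω.E := by
  simp [edgeIndicator]

theorem eq_of_mem_of_mem {i j : Fin n} {v : α} (hi : v ∈ Ω.V i) (hj : v ∈ Ω.V j) : i = j := by
  by_contra h
  exact Finset.disjoint_left.1 (Ω.disjoint i j h) hi hj

theorem mem_transversal_iff {p : Fin n → Fin m} {i : Fin n} {x : Fin m} :
    (ε i x : α) ∈ Ω.transversal ε p ↔ p i = x := by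
  simp only [transversal, Finset.mem_image, Finset.mem_univ, true_and]
  constructor
  · rintro ⟨j, hj⟩
    obtain rfl : j = i := eq_of_mem_of_mem (ε j (p j)).2 (hj ▸ (ε i x).2)
    exact (ε j).injective (Subtype.ext hj)
  · rintro rfl
    exact ⟨i, rfl⟩

theorem transversal_injective : Function.Injective (Ω.transversal ε) := by
  intro p q h
  funext i
  rw [eq_comm, ← mem_transversal_iff (Ω := Ω) (ε := ε), ← h, mem_transversal_iff]

theorem exists_transversal_eq {e : Finset α} (he : e ∈ Ω.E) : ∃ p, Ω.transversal ε p = e := by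
  choose v hv using fun i => Finset.card_eq_one.1 (Ω.card_inter_of_mem e he i)
  have hmem : ∀ i, v i ∈ e ∧ v i ∈ Ω.V i := fun i =>
    Finset.mem_inter.1 (by rw [hv i]; exact Finset.mem_singleton_self _)
  refine ⟨fun i => (ε i).symm ⟨v i, (hmem i).2⟩, ?_⟩
  ext w
  simp only [transversal, Equiv.apply_symm_apply, Finset.mem_image, Finset.mem_univ, true_and]
  constructor
  · rintro ⟨i, rfl⟩
    exact (hmem i).1
  · intro hw
    obtain ⟨i, -, hi⟩ := Finset.mem_biUnion.1 (Ω.subset_of_mem e he hw)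
    refine ⟨i, ?_⟩
    have : w ∈ e ∩ Ω.V i := Finset.mem_inter.2 ⟨hw, hi⟩
    rw [hv i, Finset.mem_singleton] at this
    exact this.symm

theorem hammingNorm_edgeIndicator : hammingNorm (Ω.edgeIndicator ε) = Ω.E.card := by
  refine Finset.card_nbij (Ω.transversal ε) ?_ transversal_injective.injOn ?_
  · intro p hp
    simpa [edgeIndicator_ne_zero] using hp
  · intro e he
    obtain ⟨p, rfl⟩ := exists_transversal_eq (ε := ε) he
    exact ⟨p, by simpa [edgeIndicator_ne_zero] using he, rfl⟩

theorem IsOctahedralSystem.isOctahedral_edgeIndicator (hΩ : Ω.IsOctahedralSystem) :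
    IsOctahedral (Ω.edgeIndicator ε) := by
  intro a b hab
  have hX : ∀ i x, (ε i x : α) ∈ Ω.transversal ε a ∪ Ω.transversal ε b ↔ a i = x ∨ b i = x := by
    intro i x
    rw [Finset.mem_union, mem_transversal_iff, mem_transversal_iff]
  have hsub : Ω.transversal ε a ∪ Ω.transversal ε b ⊆ Ω.vertexSet := by
    have : ∀ p, Ω.transversal ε p ⊆ Ω.vertexSet := by
      intro p v hv
      obtain ⟨i, -, rfl⟩ := Finset.mem_image.1 hv
      exact Finset.mem_biUnion.2 ⟨i, Finset.mem_univ i, (ε i (p i)).2⟩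
    exact Finset.union_subset (this a) (this b)
  have hcard : ∀ i, ((Ω.transversal ε a ∪ Ω.transversal ε b) ∩ Ω.V i).card = 2 := by
    intro i
    rw [Finset.card_eq_two]
    refine ⟨ε i (a i), ε i (b i), fun h => hab i ((ε i).injective (Subtype.ext h)), ?_⟩
    ext v
    simp only [Finset.mem_inter, Finset.mem_insert, Finset.mem_singleton]
    constructor
    · rintro ⟨h1, h2⟩
      obtain ⟨x, hx⟩ := (ε i).surjective ⟨v, h2⟩
      obtain rfl : (ε i x : α) = v := congrArg Subtype.val hx
      rcases (hX i x).1 h1 with rfl | rfl <;> simp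
    · rintro (rfl | rfl)
      · exact ⟨(hX _ _).2 (Or.inl rfl), (ε i (a i)).2⟩
      · exact ⟨(hX _ _).2 (Or.inr rfl), (ε i (b i)).2⟩
  have heven := hΩ.parity _ hsub hcard
  have hbij : (Finset.univ.filter fun σ : Fin n → Bool =>
      Ω.transversal ε (fun i => if σ i then a i else b i) ∈ Ω.E).card =
      (Ω.inducedEdges (Ω.transversal ε a ∪ Ω.transversal ε b)).card := by
    refine Finset.card_nbij (fun σ => Ω.transversal ε (fun i => if σ i then a i else b i))
      ?_ ?_ ?_
    · intro σ hσ
      refine Finset.mem_filter.2 ⟨by simpa using hσ, ?_⟩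
      intro v hv
      obtain ⟨i, -, rfl⟩ := Finset.mem_image.1 hv
      rw [hX]
      by_cases h : σ i <;> simp [h]
    · intro σ _ τ _ h
      funext i
      have h1 := congrFun (transversal_injective h) i
      have h2 := hab i
      revert h1
      cases σ i <;> cases τ i <;> simp [h2, h2.symm]
    · intro e he
      obtain ⟨heE, heX⟩ := Finset.mem_filter.1 he
      obtain ⟨p, rfl⟩ := exists_transversal_eq (ε := ε) heE
      have hp : (fun i => if decide (p i = a i) then a i else b i) = p := by
        funext i
        by_cases h : p i = a i
        · simp [h]
        · have := (hX i (p i)).1 (heX (mem_transversal_iff.2 rfl))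
          simp only [h, decide_false, Bool.false_eq_true, if_false]
          exact this.resolve_left (fun h' => h h'.symm)
      refine ⟨fun i => decide (p i = a i), ?_, ?_⟩
      · simp only [Finset.coe_filter, Finset.mem_univ, true_and, Set.mem_ofPred_eq]
        rwa [hp]
      · simp only [hp]
  simp only [edgeIndicator, Finset.sum_boole]
  rw [hbij, ZMod.natCast_eq_zero_iff]
  exact heven.two_dvd

theorem NoIsolatedVertex.covers (hiso : Ω.NoIsolatedVertex) (j : Fin n) :
    Covers (Ω.edgeIndicator ε) j := by
  intro v
  obtain ⟨e, he, hv⟩ := hiso (ε j v)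
    (Finset.mem_biUnion.2 ⟨j, Finset.mem_univ j, (ε j v).2⟩)
  obtain ⟨p, rfl⟩ := exists_transversal_eq (ε := ε) he
  exact ⟨p, edgeIndicator_ne_zero.2 he, mem_transversal_iff.1 hv⟩

end PartiteHypergraph

theorem theorem1 {α : Type*} [DecidableEq α] (n m : ℕ) (Ω : PartiteHypergraph α n)
    (hΩ : Ω.IsOctahedralSystem) (hiso : Ω.NoIsolatedVertex)
    (hV : ∀ i : Fin n, (Ω.V i).card = m) (hm : 4 ≤ m) (hmn : m ≤ n) :
    (1 / 2 : ℝ) * (m : ℝ) ^ 2 + (5 / 2 : ℝ) * (m : ℝ) - 11 ≤ (Ω.E.card : ℝ) := by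
  obtain ⟨d, rfl⟩ : ∃ d, m = d + 2 := ⟨m - 2, by omega⟩
  let ε : ∀ i, Fin (d + 2) ≃ Ω.V i := fun i => (Finset.equivFinOfCardEq (hV i)).symm
  -- Exactly m classes are kept, the most that the bound allows.
  obtain ⟨K, -, hK⟩ := Finset.exists_subset_card_eq (s := (Finset.univ : Finset (Fin n)))
    (n := d + 2) (by simpa using hmn)
  have hcov : ∀ j, Octahedral.Covers (Ω.edgeIndicator ε) j := hiso.covers
  have h := (hΩ.isOctahedral_edgeIndicator (ε := ε)).card_mul_add_two_le (d := d) (by omega)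
    (by simp) (hcov ⟨0, by omega⟩).ne_zero K (fun j _ => hcov j) hK.le
  rw [PartiteHypergraph.hammingNorm_edgeIndicator, hK] at h
  have h' : ((d + 2) * d + 2 : ℝ) ≤ Ω.E.card := by exact_mod_cast h
  push_cast
  -- The surplus is (d² - 5d + 12)/2; the hint completes the square.
  nlinarith [sq_nonneg ((d : ℝ) - 5 / 2)]
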